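/- **Setting.** Let $1\le M\le K$ be integers, $\mathbb F_q$ a finite field and $L\ge 1$. A server stores $K$ independent messages $W_1,\dots,W_K$, each uniform on $\mathbb F_q^L$. Let $S$ be uniform among the $M$-element subsets of $[K]$, $\theta$ uniform on $[K]$, and $\Lambda=(\lambda_1,\dots,\lambda_M)$ uniform on $(\mathbb F_q^\times)^M$, with $\theta,S,\Lambda,W_{[K]}$ independent. The user knows $(\theta,S,\Lambda)$ and the coded side information (CSI) $Y^{[S,\Lambda]}=\sum_{m=1}^M\lambda_mW_{S(m)}$, where $S(m)$ is the $m$-th smallest element of $S$. The user sends a discrete random query $Q$ with $(Q,\theta,S,\Lambda)$ independent of $W_{[K]}$, and the server returns an answer $\Delta$ that is a function of $(Q,W_{[K]})$ and is written, given $Q$, as a prefix-free string of symbols of $\mathbb F_q$ whose average length is $D$. A scheme (PIR-PCSI) must be *private*, i.e. $(\theta,S)$ is independent of $(Q,W_{[K]})$, and *correct*, i.e. $H(W_\theta\mid\Delta,Q,Y^{[S,\Lambda]},S,\Lambda,\theta)=0$. Its rate is $L/D$ (which is $\infty$ if $D=0$). The capacity $C(q)$ is the supremum of the achievable rates over all $L\ge1$,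 and the supremum capacity is $C^{\sup}=\sup_qC(q)$. For real $\alpha$, the $\alpha$-CSI constrained capacity $\overline C(q,\alpha)$ is defined like $C(q)$, except that the supremum runs over all $L\ge 1$, all families of functions $(f_{S,\Lambda})$ with $\max_{S,\Lambda}H\big(f_{S,\Lambda}(Y^{[S,\Lambda]})\big)\le\alpha L$ (entropy in $q$-ary units), and all private schemes that are correct with $Y^{[S,\Lambda]}$ replaced by $f_{S,\Lambda}(Y^{[S,\Lambda]})$. Call $\alpha$-CSI *sufficient* if $\sup_q\overline C(q,\alpha)=C^{\sup}$, let $\alpha^*$ be the infimum of the $\alpha$ such that $\alpha$-CSI is sufficient, and let $\rho=1-\alpha^*$ be the *redundancy* of the CSI. **Theorem.** For all $1\le M\le K$: - if $M=2$, then $\rho=\tfrac12$; - if $3\le M\le\frac{K+2}2$, then $\rho\le\frac1M$; - otherwise (that is, if $M=1$, or $M\ge3$ and $M>\frac{K+2}2$), $\rho=0$. Moreover, in the first and the last case the infimum $\alpha^*$ (equal to $\tfrac12$ and to $1$, respectively) is attained: $\alpha^*$-CSI is sufficient. -/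

import Mathlib

open scoped ENNReal

noncomputable section

namespace PIRPCSI

/-- The possible support sets of the side information: the `M`-element subsets of the index
set of the `K` messages. -/
abbrev Support (K M : ℕ) : Type := {S : Finset (Fin K) // S.card = M}

/-- The possible coefficient vectors: `M` nonzero field elements. -/
abbrev Coeffs (F : Type) [Field F] (M : ℕ) : Type := Fin M → Fˣ

/-- The realizations of the `K` messages, each a vector of `L` symbols of the base field. -/
abbrev Messages (F : Type) (K L : ℕ) : Type := Fin K → Fin L → F

/-- The coded side information `Y = λ₁ W_{S(1)} + ⋯ + λ_M W_{S(M)}`, where `S(m)` is the `m`-th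
element of `S` in ascending order. -/
def csi {K M L : ℕ} {F : Type} [Field F] (S : Support K M) (Lam : Coeffs F M)
    (W : Messages F K L) : Fin L → F :=
  ∑ m : Fin M, (Lam m : F) • W (S.1.orderEmbOfFin S.2 m)

/-- A family of functions `f_{S,Λ}` that process the side information; `A` is the alphabet of
the processed side information. -/
abbrev Processing (K M L : ℕ) (F : Type) [Field F] (A : Type) : Type :=
  Support K M → Coeffs F M → (Fin L → F) → A

/-- Keeping all of the side information. -/
def fullCSI (K M L : ℕ) (F : Type) [Field F] : Processing K M L F (Fin L → F) :=
  fun _ _ Y => Y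

/-- The Shannon entropy, to the base `b`, of the random variable `X w`, for `w` uniformly
distributed on the finite set `Ω`. -/
def entropy {Ω A : Type} [Fintype Ω] (b : ℕ) (X : Ω → A) : ℝ := by
  classical
  exact ∑ a ∈ Finset.univ.image X,
    Real.negMulLog (((Finset.univ.filter fun w => X w = a).card : ℝ) / (Fintype.card Ω : ℝ)) /
      Real.log (b : ℝ)

/-- The processing `f` uses no more than `α`-CSI: the maximum over `(S, Λ)` of the entropy of the
processed side information, in `q`-ary units with `q` the order of the field, is at most
`α * L`. -/
def UsesAtMost {K M L : ℕ} {F A : Type} [Field F] [Fintype F] (f : Processing K M L F A)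
    (α : ℝ) : Prop :=
  ∀ (S : Support K M) (Lam : Coeffs F M),
    entropy (Fintype.card F) (fun W : Messages F K L => f S Lam (csi S Lam W)) ≤ α * L

/-- The queries and the answers of a retrieval scheme. The query is drawn by the user from a
discrete distribution that may depend on `(θ, S, Λ)`, and not on the messages. The
answer is a function of the query and the messages. It is a string of symbols of the base field,
whose length may vary; given the query, no possible answer is a proper initial segment of another
one, so that the strings are self-delimiting. -/
structure Scheme (K M L : ℕ) (F : Type) [Field F] where
  Query : Type
  query : Fin K → Support K M → Coeffs F M → PMF Query
  answer : Query → Messages F K L → List F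
  prefix_free : ∀ (Q : Query) (W W' : Messages F K L),
    answer Q W <+: answer Q W' → answer Q W = answer Q W'

namespace Scheme

variable {K M L : ℕ} {F : Type} [Field F] [Fintype F] [DecidableEq F]

/-- The joint probability mass function of `(θ, S, Λ, Q, W)`: the variables `θ`, `S`, `Λ`, `W` are
independent and uniform, and `Q` is drawn according to `(θ, S, Λ)`. -/
def prob (σ : Scheme K M L F) (θ : Fin K) (S : Support K M) (Lam : Coeffs F M) (Q : σ.Query)
    (_W : Messages F K L) : ℝ≥0∞ :=
  (Fintype.card (Fin K) : ℝ≥0∞)⁻¹ * (Fintype.card (Support K M) : ℝ≥0∞)⁻¹ *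
    (Fintype.card (Coeffs F M) : ℝ≥0∞)⁻¹ * (Fintype.card (Messages F K L) : ℝ≥0∞)⁻¹ *
      σ.query θ S Lam Q

/-- Privacy: `(θ, S)` is independent of `(Q, W)`. -/
def IsPrivate (σ : Scheme K M L F) : Prop :=
  ∀ (θ : Fin K) (S : Support K M) (Q : σ.Query) (W : Messages F K L),
    ∑ Lam, σ.prob θ S Lam Q W =
      (∑ Lam, ∑' Q', ∑ W', σ.prob θ S Lam Q' W') * (∑ θ', ∑ S', ∑ Lam, σ.prob θ' S' Lam Q W)

/-- Correctness with processed side information: with probability one, the desired message is a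
function of the answer, the query, the processed side information, `S`, `Λ` and `θ`. -/
def IsCorrect {A : Type} (σ : Scheme K M L F) (f : Processing K M L F A) : Prop :=
  ∃ decode : List F → σ.Query → A → Support K M → Coeffs F M → Fin K → (Fin L → F),
    ∀ (θ : Fin K) (S : Support K M) (Lam : Coeffs F M) (Q : σ.Query) (W : Messages F K L),
      σ.prob θ S Lam Q W ≠ 0 →
        decode (σ.answer Q W) Q (f S Lam (csi S Lam W)) S Lam θ = W θ

/-- The average number of downloaded symbols of the base field. -/
def avgDownload (σ : Scheme K M L F) : ℝ≥0∞ :=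
  ∑ θ, ∑ S, ∑ Lam, ∑' Q, ∑ W, σ.prob θ S Lam Q W * ((σ.answer Q W).length : ℝ≥0∞)

end Scheme

/-- `R` is the rate `L / D` of a private scheme for messages of length `L` that is correct when
decoding is based on the side information processed by `f`. -/
def IsAchievable {K M L : ℕ} {F A : Type} [Field F] [Fintype F] [DecidableEq F]
    (f : Processing K M L F A) (R : ℝ≥0∞) : Prop :=
  ∃ σ : Scheme K M L F, σ.IsPrivate ∧ σ.IsCorrect f ∧ R = (L : ℝ≥0∞) / σ.avgDownload

/-- The capacity over the field `F`: the supremum of achievable rates over all message lengths. -/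
def capacity (K M : ℕ) (F : Type) [Field F] [Fintype F] [DecidableEq F] : ℝ≥0∞ :=
  sSup {R | ∃ L : ℕ, 1 ≤ L ∧ IsAchievable (fullCSI K M L F) R}

/-- The supremum capacity: the supremum of the capacity over all finite fields. -/
def supCapacity (K M : ℕ) : ℝ≥0∞ :=
  ⨆ (F : Type) (_ : Field F) (_ : Fintype F) (_ : DecidableEq F), capacity K M F

/-- The `α`-CSI constrained capacity over the field `F`: the supremum of the rates that are
achievable with processed side information, over all message lengths and all processings that use
no more than `α`-CSI. -/
def constrainedCapacity (K M : ℕ) (F : Type) [Field F] [Fintype F] [DecidableEq F] (α : ℝ) :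
    ℝ≥0∞ :=
  sSup {R | ∃ L : ℕ, 1 ≤ L ∧ ∃ (A : Type) (f : Processing K M L F A),
    UsesAtMost f α ∧ IsAchievable f R}

/-- `α`-CSI is sufficient: the supremum over all finite fields of the `α`-CSI constrained capacity
equals the supremum capacity. -/
def CSISufficient (K M : ℕ) (α : ℝ) : Prop :=
  (⨆ (F : Type) (_ : Field F) (_ : Fintype F) (_ : DecidableEq F), constrainedCapacity K M F α) =
    supCapacity K M

/-- The redundancy `1 - α*` of the side information, where `α*` is the infimum of the `α` for which
`α`-CSI is sufficient. -/
def redundancy (K M : ℕ) : ℝ :=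
  1 - sInf {α : ℝ | CSISufficient K M α}

end PIRPCSI

end

namespace PIRPCSI

/-! ### Kraft's inequality for prefix-free codes -/

/-! Converse. By privacy, a query that occurs for one pair (θ, S) occurs for all of them, each time
with some Λ; its answer therefore serves every demand and every support. Fix S. The answer and the
messages in S determine all K messages, so it suffices to pay for the messages in S. Decoding each
from its own processed CSI costs αL apiece, whence D ≥ (K - Mα)L (`le_sum_length_of_card`). If M ≥
2, one unprocessed CSI pays for two messages, one decoded and one solved for at the end, whence D ≥
(K - 1 - (M - 2)α)L (`le_sum_length_of_two_le`). The link between lengths and entropies is Kraft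
plus Gibbs.

Achievability. Over a large field the rate 1/(K - M + 1) is reached by downloading K - M + 1 power
sums of scaled messages (`isAchievable_fullCSI`); for M = 1 differences of messages give 1/(K - 1)
(`isAchievable_fullCSI_one`). For M = 2 and L = 2, one symbol of processed CSI already gives 1/(K -
1) (`isAchievable_halfCSI`).

Comparison. For M = 1 the first bound, and for M ≥ 3 the second, is strictly worse than the achieved
rate as soon as α < 1, so α* = 1 for every M ≠ 2. For M = 2 the first bound excludes α < 1/2, and
the scheme attains 1/2. -/

theorem uniquelyDecodable_of_prefixFree {α : Type*} {S : Set (List α)}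
    (hS : ∀ a ∈ S, ∀ b ∈ S, a <+: b → a = b) (hnil : [] ∉ S) :
    InformationTheory.UniquelyDecodable S := by
  intro l₁
  induction l₁ with
  | nil =>
    intro l₂ _ h₂ h
    cases l₂ with
    | nil => rfl
    | cons b l₂ =>
      have hb : b = [] := by
        have := h.symm
        simp only [List.flatten_cons, List.flatten_nil, List.append_eq_nil_iff] at this
        exact this.1
      exact absurd (hb ▸ h₂ b (by simp)) hnil
  | cons a l₁ ih =>
    intro l₂ h₁ h₂ h
    cases l₂ with
    | nil =>
      have ha : a = [] := by
        simp only [List.flatten_cons, List.flatten_nil, List.append_eq_nil_iff] at h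
        exact h.1
      exact absurd (ha ▸ h₁ a (by simp)) hnil
    | cons b l₂ =>
      have ha := h₁ a (by simp)
      have hb := h₂ b (by simp)
      simp only [List.flatten_cons] at h
      have hab : a = b := by
        have p₁ : a <+: b ++ l₂.flatten := h ▸ List.prefix_append a _
        have p₂ : b <+: b ++ l₂.flatten := List.prefix_append b _
        rcases List.prefix_or_prefix_of_prefix p₁ p₂ with p | p
        · exact hS a ha b hb p
        · exact (hS b hb a ha p).symm
      subst hab
      rw [ih l₂ (fun w hw => h₁ w (by simp [hw])) (fun w hw => h₂ w (by simp [hw]))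
        (List.append_cancel_left h)]

/-- The empty word needs its own case: `{[]}` is prefix-free but not uniquely decodable. A constant
answer produces exactly this code. -/
theorem kraft_of_prefixFree {α : Type*} [Fintype α] [Nonempty α] (S : Finset (List α))
    (hS : ∀ a ∈ S, ∀ b ∈ S, a <+: b → a = b) :
    ∑ w ∈ S, (1 / Fintype.card α : ℝ) ^ w.length ≤ 1 := by
  by_cases hnil : [] ∈ S
  · have : S = {[]} := by
      ext b
      simp only [Finset.mem_singleton]
      exact ⟨fun hb => (hS [] hnil b hb b.nil_prefix).symm, fun hb => hb ▸ hnil⟩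
    simp [this]
  · exact InformationTheory.kraft_mcmillan_inequality
      (uniquelyDecodable_of_prefixFree hS hnil)

/-! ### Entropy of functions of a uniform variable -/

open Classical in
/-- The probability that `X w = a`, for `w` uniformly distributed on `Ω`. -/
noncomputable def freq {Ω A : Type} [Fintype Ω] (X : Ω → A) (a : A) : ℝ :=
  ((Finset.univ.filter fun w => X w = a).card : ℝ) / (Fintype.card Ω : ℝ)

variable {Ω A : Type} [Fintype Ω]

theorem freq_nonneg (X : Ω → A) (a : A) : 0 ≤ freq X a := by
  unfold freq; positivity

theorem freq_pos (X : Ω → A) (w : Ω) : 0 < freq X (X w) := by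
  classical
  have : 0 < (Finset.univ.filter fun w' => X w' = X w).card :=
    Finset.card_pos.mpr ⟨w, by simp⟩
  have h2 : 0 < Fintype.card Ω := Fintype.card_pos_iff.mpr ⟨w⟩
  unfold freq
  have h1 : (0 : ℝ) < ((Finset.univ.filter fun w' => X w' = X w).card : ℝ) := by
    exact_mod_cast this
  convert div_pos h1 (show (0 : ℝ) < Fintype.card Ω by exact_mod_cast h2)

open Classical in
theorem sum_image_freq [Nonempty Ω] (X : Ω → A) :
    ∑ a ∈ Finset.univ.image X, freq X a = 1 := by
  unfold freq
  rw [← Finset.sum_div, ← Nat.cast_sum, ← Finset.card_eq_sum_card_image X Finset.univ,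
    Finset.card_univ, div_self]
  exact_mod_cast Fintype.card_ne_zero

open Classical in
theorem sum_image_freq_mul [Nonempty Ω] (X : Ω → A) (g : A → ℝ) :
    ∑ a ∈ Finset.univ.image X, freq X a * g a = (∑ w, g (X w)) / Fintype.card Ω := by
  rw [← Finset.sum_fiberwise_of_maps_to (s := Finset.univ) (t := Finset.univ.image X) (g := X)
    (fun w _ => Finset.mem_image_of_mem X (Finset.mem_univ w)), Finset.sum_div]
  refine Finset.sum_congr rfl fun a _ => ?_
  rw [Finset.sum_congr rfl (g := fun _ => g a)
    (fun w hw => by rw [(Finset.mem_filter.mp hw).2]), Finset.sum_const, nsmul_eq_mul]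
  unfold freq
  ring

theorem entropy_mul_log_mul_card [Nonempty Ω] {b : ℕ} (hb : 2 ≤ b) (X : Ω → A) :
    entropy b X * Real.log b * Fintype.card Ω = ∑ w, -Real.log (freq X (X w)) := by
  classical
  have hlog : Real.log b ≠ 0 := (Real.log_pos (by exact_mod_cast hb)).ne'
  have h : entropy b X =
      (∑ a ∈ Finset.univ.image X, freq X a * -Real.log (freq X a)) / Real.log b := by
    unfold entropy
    rw [Finset.sum_div]
    refine Finset.sum_congr ?_ fun a _ => ?_
    · congr!
    · unfold freq Real.negMulLog
      rw [neg_mul_comm]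
  have hN : (Fintype.card Ω : ℝ) ≠ 0 := by exact_mod_cast Fintype.card_ne_zero
  rw [h, sum_image_freq_mul]
  field_simp

/-- Gibbs against the uniform law on `A`: average log t ≤ t - 1 at t = 1/(|A| p(a)). The image has
at most |A| points, so the mean of t is at most 1. -/
theorem entropy_le_log_card [Fintype A] [Nonempty Ω] (b : ℕ) (hb : 2 ≤ b) (X : Ω → A) :
    entropy b X ≤ Real.log (Fintype.card A) / Real.log b := by
  classical
  have hlog : 0 < Real.log b := Real.log_pos (by exact_mod_cast hb)
  have hΩ : (0 : ℝ) < Fintype.card Ω := by exact_mod_cast Fintype.card_pos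
  have hA : (0 : ℝ) < Fintype.card A := by
    have : Nonempty A := ⟨X (Classical.arbitrary Ω)⟩
    exact_mod_cast Fintype.card_pos
  have h := entropy_mul_log_mul_card hb X
  rw [le_div_iff₀ hlog]
  refine le_of_mul_le_mul_right ?_ hΩ
  rw [h]
  have key : ∀ w, -Real.log (freq X (X w)) ≤
      Real.log (Fintype.card A) + (1 / (Fintype.card A * freq X (X w)) - 1) := by
    intro w
    have hp := freq_pos X w
    have := Real.log_le_sub_one_of_pos
      (show 0 < 1 / (Fintype.card A * freq X (X w)) by positivity)
    rw [one_div, Real.log_inv, Real.log_mul hA.ne' hp.ne'] at this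
    rw [one_div]
    linarith
  refine (Finset.sum_le_sum fun w _ => key w).trans ?_
  rw [Finset.sum_add_distrib, Finset.sum_const, Finset.card_univ, nsmul_eq_mul,
    mul_comm (Real.log _)]
  suffices ∑ w, (1 / (Fintype.card A * freq X (X w)) - 1) ≤ 0 by linarith
  have h2 := sum_image_freq_mul X fun a => 1 / (Fintype.card A * freq X a) - 1
  rw [eq_div_iff hΩ.ne'] at h2
  rw [← h2]
  refine mul_nonpos_of_nonpos_of_nonneg ?_ hΩ.le
  simp only [mul_sub, mul_one, Finset.sum_sub_distrib, sum_image_freq]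
  rw [sub_nonpos, Finset.sum_congr rfl (g := fun _ => 1 / (Fintype.card A : ℝ))]
  · rw [Finset.sum_const, nsmul_eq_mul, mul_one_div, div_le_one hA]
    exact_mod_cast Finset.card_le_univ _
  · intro a ha
    obtain ⟨w, -, rfl⟩ := Finset.mem_image.mp ha
    have := freq_pos X w
    field_simp

/-- Gibbs' inequality against a subprobability weight. -/
theorem card_mul_log_card_le [Nonempty Ω] (G : Ω → ℝ) (hG : ∀ w, 0 < G w)
    (hsum : ∑ w, G w ≤ 1) :
    Fintype.card Ω * Real.log (Fintype.card Ω) ≤ ∑ w, -Real.log (G w) := by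
  have hΩ : (0 : ℝ) < Fintype.card Ω := by exact_mod_cast Fintype.card_pos
  have key : ∀ w, Real.log (Fintype.card Ω) - (Fintype.card Ω * G w - 1) ≤ -Real.log (G w) := by
    intro w
    have := Real.log_le_sub_one_of_pos (mul_pos hΩ (hG w))
    rw [Real.log_mul hΩ.ne' (hG w).ne'] at this
    linarith
  refine le_trans ?_ (Finset.sum_le_sum fun w _ => key w)
  rw [Finset.sum_sub_distrib, Finset.sum_sub_distrib, ← Finset.mul_sum]
  simp only [Finset.sum_const, Finset.card_univ, nsmul_eq_mul, mul_one]
  nlinarith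

/-- If a uniform variable `w` is determined by a codeword from a prefix-free code together with `Y`
and the `X i`, then the expected length of the codeword and the entropies of `Y` and the `X i` add
up to at least the entropy of `w`. -/
theorem log_card_le_length_add_entropy {F B ι : Type} [Fintype F] [Fintype ι] [Nonempty Ω]
    (hF : 2 ≤ Fintype.card F) (δ : Ω → List F)
    (hδ : ∀ w w', δ w <+: δ w' → δ w = δ w') (Y : Ω → B) (X : ι → Ω → A)
    (hinj : ∀ w w', δ w = δ w' → Y w = Y w' → (∀ i, X i w = X i w') → w = w') :
    Fintype.card Ω * (Real.log (Fintype.card Ω) / Real.log (Fintype.card F)) ≤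
      ∑ w, ((δ w).length : ℝ) + Fintype.card Ω * (entropy (Fintype.card F) Y +
        ∑ i, entropy (Fintype.card F) (X i)) := by
  classical
  have hq : (0 : ℝ) < Fintype.card F := by exact_mod_cast (by omega : 0 < Fintype.card F)
  have hlog : 0 < Real.log (Fintype.card F) := Real.log_pos (by exact_mod_cast hF)
  have : Nonempty F := Fintype.card_pos_iff.mp (by omega)
  -- The weight for Gibbs: Kraft weight times the product of the marginals. Its sum over the box `T`
  -- factorizes and is at most 1; injectivity of `φ` embeds `Ω` in `T`.
  let g : List F × B × (ι → A) → ℝ := fun x =>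
    (1 / Fintype.card F : ℝ) ^ x.1.length * (freq Y x.2.1 * ∏ i, freq (X i) (x.2.2 i))
  let φ : Ω → List F × B × (ι → A) := fun w => (δ w, Y w, fun i => X i w)
  have hφ : Function.Injective φ := by
    intro w w' h
    simp only [φ, Prod.mk.injEq] at h
    exact hinj w w' h.1 h.2.1 fun i => congrFun h.2.2 i
  let T := Finset.univ.image δ ×ˢ Finset.univ.image Y ×ˢ
    Fintype.piFinset fun i => Finset.univ.image (X i)
  have hg0 : ∀ x, 0 ≤ g x := fun x =>
    mul_nonneg (by positivity) (mul_nonneg (freq_nonneg _ _)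
      (Finset.prod_nonneg fun i _ => freq_nonneg _ _))
  have hsum : ∑ w, g (φ w) ≤ 1 := by
    rw [← Finset.sum_image (f := g) (s := Finset.univ) (g := φ) (fun _ _ _ _ h => hφ h)]
    calc ∑ x ∈ Finset.univ.image φ, g x ≤ ∑ x ∈ T, g x := by
          refine Finset.sum_le_sum_of_subset_of_nonneg ?_ fun x _ _ => hg0 x
          intro x hx
          obtain ⟨w, -, rfl⟩ := Finset.mem_image.mp hx
          simp only [T, φ, Finset.mem_product, Fintype.mem_piFinset]
          exact ⟨Finset.mem_image_of_mem _ (Finset.mem_univ _),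
            Finset.mem_image_of_mem _ (Finset.mem_univ _),
            fun i => Finset.mem_image_of_mem _ (Finset.mem_univ _)⟩
      _ = (∑ s ∈ Finset.univ.image δ, (1 / Fintype.card F : ℝ) ^ s.length) *
            ((∑ y ∈ Finset.univ.image Y, freq Y y) *
              ∏ i, ∑ a ∈ Finset.univ.image (X i), freq (X i) a) := by
          rw [Finset.prod_univ_sum, Finset.sum_mul_sum, Finset.sum_mul_sum,
            Finset.sum_product]
          refine Finset.sum_congr rfl fun s _ => ?_
          rw [Finset.sum_product, ← Finset.mul_sum]
          simp only [g, Finset.mul_sum]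
      _ ≤ 1 := by
          simp only [sum_image_freq, Finset.prod_const_one, mul_one]
          refine kraft_of_prefixFree _ ?_
          intro a ha b hb
          obtain ⟨w, -, rfl⟩ := Finset.mem_image.mp ha
          obtain ⟨w', -, rfl⟩ := Finset.mem_image.mp hb
          exact hδ w w'
  have hpos : ∀ w, 0 < g (φ w) := fun w =>
    mul_pos (by positivity) (mul_pos (freq_pos Y w) (Finset.prod_pos fun i _ => freq_pos (X i) w))
  have h := card_mul_log_card_le (fun w => g (φ w)) hpos hsum
  have hlogg : ∀ w, -Real.log (g (φ w)) = (δ w).length * Real.log (Fintype.card F) +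
      (-Real.log (freq Y (Y w)) + ∑ i, -Real.log (freq (X i) (X i w))) := by
    intro w
    simp only [g, φ]
    rw [Real.log_mul (by positivity) (mul_ne_zero (freq_pos Y w).ne'
        (Finset.prod_ne_zero_iff.mpr fun i _ => (freq_pos (X i) w).ne')),
      Real.log_mul (freq_pos Y w).ne' (Finset.prod_ne_zero_iff.mpr fun i _ =>
        (freq_pos (X i) w).ne'), Real.log_prod (fun i _ => (freq_pos (X i) w).ne'),
      Real.log_pow, one_div, Real.log_inv, Finset.sum_neg_distrib]
    ring
  have hY := entropy_mul_log_mul_card hF Y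
  have hX := fun i => entropy_mul_log_mul_card hF (X i)
  rw [Finset.sum_congr rfl fun w _ => hlogg w, Finset.sum_add_distrib, Finset.sum_add_distrib,
    Finset.sum_comm, ← hY, Finset.sum_congr rfl fun i _ => (hX i).symm, ← Finset.sum_mul,
    ← Finset.sum_mul, ← Finset.sum_mul] at h
  refine le_of_mul_le_mul_right ?_ hlog
  rw [mul_assoc, div_mul_cancel₀ _ hlog.ne']
  linarith

end PIRPCSI

/-! ### Average download and privacy -/

namespace PIRPCSI

theorem nonempty_support {K M : ℕ} (hMK : M ≤ K) : Nonempty (Support K M) := by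
  obtain ⟨S, -, hS⟩ := Finset.exists_subset_card_eq
    (s := (Finset.univ : Finset (Fin K))) (n := M) (by simpa using hMK)
  exact ⟨⟨S, hS⟩⟩

namespace Scheme

variable {K M L : ℕ} {F : Type} [Field F] [Fintype F] [DecidableEq F]

theorem prob_ne_zero_iff (σ : Scheme K M L F) (θ : Fin K) (S : Support K M) (Lam : Coeffs F M)
    (Q : σ.Query) (W : Messages F K L) : σ.prob θ S Lam Q W ≠ 0 ↔ σ.query θ S Lam Q ≠ 0 := by
  unfold prob
  rw [mul_ne_zero_iff, and_iff_right]
  refine mul_ne_zero (mul_ne_zero (mul_ne_zero ?_ ?_) ?_) ?_ <;>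
    exact ENNReal.inv_ne_zero.mpr (ENNReal.natCast_ne_top _)

theorem sum_prior_mul_query (hK : 1 ≤ K) (hMK : M ≤ K) (σ : Scheme K M L F) (d : ℝ≥0∞) :
    ∑ θ, ∑ S, ∑ Lam, ∑' Q, (Fintype.card (Fin K) : ℝ≥0∞)⁻¹ *
      (Fintype.card (Support K M) : ℝ≥0∞)⁻¹ * (Fintype.card (Coeffs F M) : ℝ≥0∞)⁻¹ *
        σ.query θ S Lam Q * d = d := by
  have hS := nonempty_support hMK
  have hF : Nonempty (Fin K) := ⟨⟨0, hK⟩⟩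
  have inv : ∀ (A : Type) [Fintype A] [Nonempty A],
      (Fintype.card A : ℝ≥0∞) * (Fintype.card A : ℝ≥0∞)⁻¹ = 1 := fun A _ _ =>
    ENNReal.mul_inv_cancel (by exact_mod_cast Fintype.card_ne_zero) (ENNReal.natCast_ne_top _)
  simp only [ENNReal.tsum_mul_right, ENNReal.tsum_mul_left, PMF.tsum_coe, mul_one,
    Finset.sum_const, Finset.card_univ, nsmul_eq_mul]
  calc _ = ((Fintype.card (Fin K) : ℝ≥0∞) * (Fintype.card (Fin K) : ℝ≥0∞)⁻¹) *
        ((Fintype.card (Support K M) : ℝ≥0∞) * (Fintype.card (Support K M) : ℝ≥0∞)⁻¹) *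
        ((Fintype.card (Coeffs F M) : ℝ≥0∞) * (Fintype.card (Coeffs F M) : ℝ≥0∞)⁻¹) * d := by
          ring
    _ = d := by rw [inv, inv, inv]; simp

theorem avgDownload_eq_sum (σ : Scheme K M L F) :
    σ.avgDownload = ∑ θ, ∑ S, ∑ Lam, ∑' Q, (Fintype.card (Fin K) : ℝ≥0∞)⁻¹ *
      (Fintype.card (Support K M) : ℝ≥0∞)⁻¹ * (Fintype.card (Coeffs F M) : ℝ≥0∞)⁻¹ *
        σ.query θ S Lam Q * ((Fintype.card (Messages F K L) : ℝ≥0∞)⁻¹ *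
          ∑ W, ((σ.answer Q W).length : ℝ≥0∞)) := by
  unfold avgDownload prob
  refine Finset.sum_congr rfl fun θ _ => Finset.sum_congr rfl fun S _ =>
    Finset.sum_congr rfl fun Lam _ => tsum_congr fun Q => ?_
  rw [← Finset.mul_sum]
  ring

/-- The download is a mean over queries, so the converse may be proved for one query at a time. -/
theorem le_avgDownload (hK : 1 ≤ K) (hMK : M ≤ K) (σ : Scheme K M L F) (d : ℝ≥0∞)
    (h : ∀ θ S Lam Q, σ.query θ S Lam Q ≠ 0 → d ≤ (Fintype.card (Messages F K L) : ℝ≥0∞)⁻¹ *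
      ∑ W, ((σ.answer Q W).length : ℝ≥0∞)) :
    d ≤ σ.avgDownload := by
  rw [avgDownload_eq_sum, ← sum_prior_mul_query hK hMK σ d]
  refine Finset.sum_le_sum fun θ _ => Finset.sum_le_sum fun S _ =>
    Finset.sum_le_sum fun Lam _ => ENNReal.tsum_le_tsum fun Q => ?_
  by_cases hQ : σ.query θ S Lam Q = 0
  · simp [hQ]
  · gcongr
    exact h θ S Lam Q hQ

theorem avgDownload_of_length_eq (hK : 1 ≤ K) (hMK : M ≤ K) (σ : Scheme K M L F) (n : ℕ)
    (h : ∀ Q W, (σ.answer Q W).length = n) : σ.avgDownload = n := by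
  rw [avgDownload_eq_sum, ← sum_prior_mul_query hK hMK σ n]
  simp only [h, Finset.sum_const, Finset.card_univ, nsmul_eq_mul]
  rw [← mul_assoc, ENNReal.inv_mul_cancel (by exact_mod_cast Fintype.card_ne_zero)
    (ENNReal.natCast_ne_top _), one_mul, sum_prior_mul_query hK hMK σ n]

/-- By privacy, a query that occurs at all occurs for every demand and every support. -/
theorem IsPrivate.exists_query_ne_zero {σ : Scheme K M L F} (hσ : σ.IsPrivate) {θ : Fin K}
    {S : Support K M} {Lam : Coeffs F M} {Q : σ.Query} (hQ : σ.query θ S Lam Q ≠ 0)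
    (θ' : Fin K) (S' : Support K M) : ∃ Lam', σ.query θ' S' Lam' Q ≠ 0 := by
  classical
  -- Any realization would do, since `prob` does not depend on it.
  let W : Messages F K L := 0
  by_contra! hzero
  have h := hσ θ' S' Q W
  have hl : ∑ Lam, σ.prob θ' S' Lam Q W = 0 := by
    simp [prob, hzero]
  rw [hl] at h
  have h1 : ∑ Lam, ∑' Q', ∑ W', σ.prob θ' S' Lam Q' W' ≠ 0 := by
    obtain ⟨Q', hQ'⟩ := (σ.query θ' S' Lam).support_nonempty
    intro h0
    have h0 := Finset.sum_eq_zero_iff.mp h0 Lam (Finset.mem_univ _)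
    have h0 := ENNReal.tsum_eq_zero.mp h0 Q'
    have h0 := Finset.sum_eq_zero_iff.mp h0 W (Finset.mem_univ _)
    exact (σ.prob_ne_zero_iff ..).mpr ((PMF.mem_support_iff _ _).mp hQ') h0
  have h2 : ∑ θ', ∑ S', ∑ Lam, σ.prob θ' S' Lam Q W ≠ 0 := by
    intro h0
    have h0 := Finset.sum_eq_zero_iff.mp h0 θ (Finset.mem_univ _)
    have h0 := Finset.sum_eq_zero_iff.mp h0 S (Finset.mem_univ _)
    have h0 := Finset.sum_eq_zero_iff.mp h0 Lam (Finset.mem_univ _)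
    exact (σ.prob_ne_zero_iff ..).mpr hQ h0
  exact mul_ne_zero h1 h2 h.symm

end Scheme

/-! ### Converse bounds for a fixed query -/

variable {K M L : ℕ} {F A : Type} [Field F]

/-- The messages outside `S` do not enter the side information. -/
theorem csi_congr {S : Support K M} {W W' : Messages F K L} (h : ∀ i ∈ S.1, W i = W' i)
    (Lam : Coeffs F M) : csi S Lam W = csi S Lam W' := by
  unfold csi
  refine Finset.sum_congr rfl fun m _ => ?_
  rw [h _ (Finset.orderEmbOfFin_mem _ _ _)]

/-- The side information and all but one of the messages it combines determine the last one. -/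
theorem eq_of_csi_eq {S : Support K M} {W W' : Messages F K L} {Lam : Coeffs F M} {k : Fin K}
    (hk : k ∈ S.1) (hcsi : csi S Lam W = csi S Lam W') (h : ∀ i ∈ S.1, i ≠ k → W i = W' i) :
    W k = W' k := by
  obtain ⟨m, hm⟩ : ∃ m, S.1.orderEmbOfFin S.2 m = k := by
    have : k ∈ Set.range (S.1.orderEmbOfFin S.2) := by
      rw [Finset.range_orderEmbOfFin]; exact hk
    exact this
  unfold csi at hcsi
  rw [← Finset.add_sum_erase _ _ (Finset.mem_univ m), ← Finset.add_sum_erase _ _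
    (Finset.mem_univ m)] at hcsi
  rw [Finset.sum_congr rfl (s₁ := Finset.univ.erase m)
    (g := fun m => (Lam m : F) • W' (S.1.orderEmbOfFin S.2 m))] at hcsi
  · have := add_right_cancel hcsi
    rw [hm] at this
    exact smul_right_injective _ (Lam m).ne_zero this
  · intro m' hm'
    rw [h _ (Finset.orderEmbOfFin_mem _ _ _)]
    rw [← hm]
    exact fun h => (Finset.mem_erase.mp hm').1 ((S.1.orderEmbOfFin S.2).injective h)

/-- The answer function `δ` serves every demand and every support, for suitable coefficients. -/
def Serves (f : Processing K M L F A) (δ : Messages F K L → List F) : Prop :=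
  ∀ (θ : Fin K) (S : Support K M), ∃ Lam, ∀ W W', δ W = δ W' →
    f S Lam (csi S Lam W) = f S Lam (csi S Lam W') → W θ = W' θ

/-- Whichever Λ goes with a demand, its CSI is a function of the messages in `S`; so these and the
answer decode every demand. -/
theorem Serves.eq_of_eq_on {f : Processing K M L F A} {δ : Messages F K L → List F}
    (h : Serves f δ) (S : Support K M) {W W' : Messages F K L} (hδ : δ W = δ W')
    (hS : ∀ i ∈ S.1, W i = W' i) : W = W' := by
  funext θ
  obtain ⟨Lam, hLam⟩ := h θ S
  exact hLam W W' hδ (by rw [csi_congr hS])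

variable [Fintype F]

theorem serves_answer [DecidableEq F] {σ : Scheme K M L F} (hσ : σ.IsPrivate) {f : Processing K M L F A}
    (hf : σ.IsCorrect f) {θ : Fin K} {S : Support K M} {Lam : Coeffs F M} {Q : σ.Query}
    (hQ : σ.query θ S Lam Q ≠ 0) : Serves f (σ.answer Q) := by
  intro θ' S'
  obtain ⟨Lam', h'⟩ := hσ.exists_query_ne_zero hQ θ' S'
  obtain ⟨dec, hdec⟩ := hf
  refine ⟨Lam', fun W W' hδ hY => ?_⟩
  rw [← hdec θ' S' Lam' Q W ((σ.prob_ne_zero_iff ..).mpr h'),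
    ← hdec θ' S' Lam' Q W' ((σ.prob_ne_zero_iff ..).mpr h'), hδ, hY]

theorem log_card_messages :
    Real.log (Fintype.card (Messages F K L)) / Real.log (Fintype.card F) = K * L := by
  have hlog : 0 < Real.log (Fintype.card F) :=
    Real.log_pos (by exact_mod_cast Fintype.one_lt_card)
  rw [div_eq_iff hlog.ne']
  simp only [Fintype.card_fun, Fintype.card_fin, Nat.cast_pow, Real.log_pow]
  ring

theorem entropy_vector_le {Ω : Type} [Fintype Ω] [Nonempty Ω] (X : Ω → Fin L → F) :
    entropy (Fintype.card F) X ≤ L := by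
  have hlog : 0 < Real.log (Fintype.card F) :=
    Real.log_pos (by exact_mod_cast Fintype.one_lt_card)
  refine (entropy_le_log_card _ Fintype.one_lt_card X).trans_eq ?_
  rw [div_eq_iff hlog.ne']
  simp only [Fintype.card_fun, Fintype.card_fin, Nat.cast_pow, Real.log_pow]

theorem usesAtMost_fullCSI : UsesAtMost (fullCSI K M L F) 1 := fun S Lam => by
  rw [one_mul]
  exact entropy_vector_le _

/-- Each of the M messages in S is decoded from the answer and a processed CSI of entropy at most
αL; the messages outside S then follow. -/
theorem le_sum_length_of_card {f : Processing K M L F A} {α : ℝ} (hα : UsesAtMost f α)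
    (hMK : M ≤ K) {δ : Messages F K L → List F} (hδ : ∀ W W', δ W <+: δ W' → δ W = δ W')
    (hs : Serves f δ) :
    Fintype.card (Messages F K L) * ((K - M * α) * L) ≤ ∑ W, ((δ W).length : ℝ) := by
  obtain ⟨S⟩ := nonempty_support hMK
  choose Lam hLam using fun θ => hs θ S
  have h := log_card_le_length_add_entropy (F := F) Fintype.one_lt_card δ hδ
    -- No unprocessed CSI is used here, so that slot holds a constant.
    (fun _ => ()) (fun (i : S.1) W => f S (Lam i) (csi S (Lam i) W)) (by
      intro W W' h1 _ h3
      exact hs.eq_of_eq_on S h1 fun i hi => hLam i W W' h1 (h3 ⟨i, hi⟩))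
  rw [log_card_messages] at h
  have h0 : entropy (Fintype.card F) (fun _ : Messages F K L => ()) ≤ 0 := by
    simpa using entropy_le_log_card _ Fintype.one_lt_card (fun _ : Messages F K L => ())
  have h1 : ∑ i : S.1, entropy (Fintype.card F)
      (fun W : Messages F K L => f S (Lam i) (csi S (Lam i) W)) ≤ M * (α * L) := by
    refine (Finset.sum_le_sum fun (i : S.1) _ => hα S (Lam i)).trans_eq ?_
    simp [S.2]
  have h2 := mul_le_mul_of_nonneg_left (add_le_add h0 h1)
    (Nat.cast_nonneg (α := ℝ) (Fintype.card (Messages F K L)))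
  linarith

/-- The whole CSI for the coefficients of one demand θ ∈ S costs at most L. Processing it yields
W_θ; M - 2 further messages cost αL each; the last message W_k is then solved for from that same
CSI. -/
theorem le_sum_length_of_two_le {f : Processing K M L F A} {α : ℝ} (hα : UsesAtMost f α)
    (hM : 2 ≤ M) (hMK : M ≤ K) {δ : Messages F K L → List F}
    (hδ : ∀ W W', δ W <+: δ W' → δ W = δ W') (hs : Serves f δ) :
    Fintype.card (Messages F K L) * ((K - (1 + (M - 2) * α)) * L) ≤
      ∑ W, ((δ W).length : ℝ) := by
  obtain ⟨S⟩ := nonempty_support hMK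
  obtain ⟨θ, hθ, k, hk, hθk⟩ := Finset.one_lt_card.mp (show 1 < S.1.card by rw [S.2]; omega)
  choose Lam hLam using fun θ => hs θ S
  have h := log_card_le_length_add_entropy (F := F) Fintype.one_lt_card δ hδ
    (csi S (Lam θ))
    (fun (i : ((S.1.erase θ).erase k : Finset _)) W => f S (Lam i) (csi S (Lam i) W)) (by
      intro W W' h1 h2 h3
      have h4 : ∀ i ∈ S.1, i ≠ k → W i = W' i := by
        intro i hi hik
        by_cases hiθ : i = θ
        · subst hiθ
          exact hLam i W W' h1 (by rw [h2])
        · exact hLam i W W' h1 (h3 ⟨i, by simp [hi, hik, hiθ]⟩)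
      refine hs.eq_of_eq_on S h1 fun i hi => ?_
      by_cases hik : i = k
      · subst hik
        exact eq_of_csi_eq hi h2 h4
      · exact h4 i hi hik)
  rw [log_card_messages] at h
  have h0 : entropy (Fintype.card F) (csi (L := L) S (Lam θ)) ≤ L := entropy_vector_le _
  have h1 : ∑ i : ((S.1.erase θ).erase k : Finset _), entropy (Fintype.card F)
      (fun W : Messages F K L => f S (Lam i) (csi S (Lam i) W)) ≤ (M - 2) * (α * L) := by
    refine (Finset.sum_le_sum fun (i : ((S.1.erase θ).erase k : Finset _)) _ =>
      hα S (Lam i)).trans_eq ?_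
    have : ((S.1.erase θ).erase k).card = M - 2 := by
      rw [Finset.card_erase_of_mem (by simp [hk, hθk.symm]), Finset.card_erase_of_mem hθ, S.2]
      omega
    rw [Finset.sum_const, Finset.card_univ, Fintype.card_coe, this, nsmul_eq_mul,
      Nat.cast_sub hM]
    simp
  have h2 := mul_le_mul_of_nonneg_left (add_le_add h0 h1)
    (Nat.cast_nonneg (α := ℝ) (Fintype.card (Messages F K L)))
  linarith

variable [DecidableEq F]

/-- For d ≤ 0 the value `ENNReal.ofReal d` is 0 and the bound is the vacuous ∞. -/
theorem rate_le_of_le_sum_length {f : Processing K M L F A} (hK : 1 ≤ K) (hMK : M ≤ K)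
    (hL : 1 ≤ L) {d : ℝ}
    (h : ∀ δ : Messages F K L → List F, (∀ W W', δ W <+: δ W' → δ W = δ W') → Serves f δ →
      Fintype.card (Messages F K L) * (d * L) ≤ ∑ W, ((δ W).length : ℝ))
    {R : ℝ≥0∞} (hR : IsAchievable f R) : R ≤ (ENNReal.ofReal d)⁻¹ := by
  obtain ⟨σ, hp, hc, rfl⟩ := hR
  have hL0 : (L : ℝ≥0∞) ≠ 0 := by exact_mod_cast (by omega : L ≠ 0)
  have hD : ENNReal.ofReal d * L ≤ σ.avgDownload := by
    refine σ.le_avgDownload hK hMK _ fun θ S Lam Q hQ => ?_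
    have h1 := ENNReal.ofReal_le_ofReal
      (h (σ.answer Q) (σ.prefix_free Q) (serves_answer hp hc hQ))
    rw [ENNReal.ofReal_mul (Nat.cast_nonneg _), ENNReal.ofReal_mul' (Nat.cast_nonneg _),
      ENNReal.ofReal_sum_of_nonneg fun _ _ => Nat.cast_nonneg _] at h1
    simp only [ENNReal.ofReal_natCast] at h1
    rw [mul_comm _ (∑ W, _), ← div_eq_mul_inv]
    rw [ENNReal.le_div_iff_mul_le (Or.inl (by exact_mod_cast Fintype.card_ne_zero))
      (Or.inl (ENNReal.natCast_ne_top _)), mul_comm]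
    exact h1
  calc (L : ℝ≥0∞) / σ.avgDownload ≤ L / (ENNReal.ofReal d * L) := ENNReal.div_le_div_left hD _
    _ = (ENNReal.ofReal d)⁻¹ := by
      rw [div_eq_mul_inv, ENNReal.mul_inv (Or.inr (ENNReal.natCast_ne_top _)) (Or.inr hL0),
        mul_comm (ENNReal.ofReal d)⁻¹, ← mul_assoc,
        ENNReal.mul_inv_cancel hL0 (ENNReal.natCast_ne_top _), one_mul]

theorem rate_le_of_usesAtMost {f : Processing K M L F A} {α : ℝ} (hα : UsesAtMost f α)
    (hM : 1 ≤ M) (hMK : M ≤ K) (hL : 1 ≤ L) {R : ℝ≥0∞} (hR : IsAchievable f R) :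
    R ≤ (ENNReal.ofReal (K - M * α))⁻¹ :=
  rate_le_of_le_sum_length (hM.trans hMK) hMK hL
    (fun _ hδ hs => le_sum_length_of_card hα hMK hδ hs) hR

theorem rate_le_of_usesAtMost_of_two_le {f : Processing K M L F A} {α : ℝ} (hα : UsesAtMost f α)
    (hM : 2 ≤ M) (hMK : M ≤ K) (hL : 1 ≤ L) {R : ℝ≥0∞} (hR : IsAchievable f R) :
    R ≤ (ENNReal.ofReal (K - (1 + (M - 2) * α)))⁻¹ :=
  rate_le_of_le_sum_length (by omega) hMK hL
    (fun _ hδ hs => le_sum_length_of_two_le hα hM hMK hδ hs) hR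

end PIRPCSI

namespace PIRPCSI

/-! ### Schemes whose query determines the coefficients -/

section Fibers

variable {K M L : ℕ} {F A : Type} [Field F] [Fintype F] [DecidableEq F]

/-- Since Λ is uniform, the sum over Λ is, up to a constant, the law of Q given (θ, S). -/
theorem Scheme.isPrivate_of_sum_query_eq (hK : 1 ≤ K) (hMK : M ≤ K) (σ : Scheme K M L F)
    (u : σ.Query → ℝ≥0∞) (hu : ∀ θ S Q, ∑ Lam, σ.query θ S Lam Q = u Q) : σ.IsPrivate := by
  have hS := nonempty_support hMK
  have hF : Nonempty (Fin K) := ⟨⟨0, hK⟩⟩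
  have inv : ∀ (A : Type) [Fintype A] [Nonempty A],
      (Fintype.card A : ℝ≥0∞) * (Fintype.card A : ℝ≥0∞)⁻¹ = 1 := fun A _ _ =>
    ENNReal.mul_inv_cancel (by exact_mod_cast Fintype.card_ne_zero) (ENNReal.natCast_ne_top _)
  intro θ S Q W
  unfold Scheme.prob
  simp only [← Finset.mul_sum, hu, ENNReal.tsum_mul_left, PMF.tsum_coe, mul_one,
    Finset.sum_const, Finset.card_univ, nsmul_eq_mul]
  generalize hk : (Fintype.card (Fin K) : ℝ≥0∞) = k
  generalize hs : (Fintype.card (Support K M) : ℝ≥0∞) = s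
  generalize hc : (Fintype.card (Coeffs F M) : ℝ≥0∞) = c
  generalize hw : (Fintype.card (Messages F K L) : ℝ≥0∞) = w
  have ik : k * k⁻¹ = 1 := hk ▸ inv _
  have is : s * s⁻¹ = 1 := hs ▸ inv _
  have ic : c * c⁻¹ = 1 := hc ▸ inv _
  have iw : w * w⁻¹ = 1 := hw ▸ inv _
  symm
  calc _ = (k * k⁻¹) * (s * s⁻¹) * (c * c⁻¹) * (w * w⁻¹) * (k⁻¹ * s⁻¹ * c⁻¹ * w⁻¹ * u Q) := by
        ring
    _ = _ := by rw [ik, is, ic, iw]; ring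

variable {G : Type} [Group G] [Fintype G]

/-- Equivariance makes the fibres equal in size: the translation attached to b a⁻¹ injects the fibre
over a into the fibre over b. -/
theorem card_coeffs_mul_card_fiber {C : Type} [Group C] [Fintype C] [DecidableEq C] {ψ : G → C}
    (hψ : ∀ g, ∃ h, ∀ Q, ψ (h * Q) = g * ψ Q) (c : C) :
    Fintype.card C * (Finset.univ.filter fun Q => ψ Q = c).card = Fintype.card G := by
  have heq : ∀ a b : C, (Finset.univ.filter fun Q => ψ Q = a).card ≤
      (Finset.univ.filter fun Q => ψ Q = b).card := by
    intro a b
    obtain ⟨h, hh⟩ := hψ (b * a⁻¹)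
    refine Finset.card_le_card_of_injOn (fun Q => h * Q) ?_
      (fun _ _ _ _ e => mul_left_cancel e)
    intro Q hQ
    simp only [Finset.coe_filter, Finset.mem_univ, true_and, Set.mem_ofPred_eq] at hQ ⊢
    rw [hh, hQ, inv_mul_cancel_right]
  have h := Finset.card_eq_sum_card_fiberwise (s := (Finset.univ : Finset G)) (f := ψ)
    (t := Finset.univ) (fun _ _ => Finset.mem_univ _)
  rw [Finset.card_univ, Finset.sum_congr rfl fun a _ => le_antisymm (heq a c) (heq c a)] at h
  rw [h, Finset.sum_const, Finset.card_univ, smul_eq_mul]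

/-- A scheme with uniform query and `Λ` a function `ψ` of `(θ, S, Q)` with fibres of equal size:
the query is uniform on the fibre over `Λ`. -/
theorem isAchievable_of_fibers (hK : 1 ≤ K) (hMK : M ≤ K) (f : Processing K M L F A)
    (ψ : Fin K → Support K M → G → Coeffs F M)
    (hψ : ∀ θ S g, ∃ h, ∀ Q, ψ θ S (h * Q) = g * ψ θ S Q)
    (ans : G → Messages F K L → List F) (n : ℕ) (hlen : ∀ Q W, (ans Q W).length = n)
    (hdec : ∀ θ S Q W W', ans Q W = ans Q W' →
      f S (ψ θ S Q) (csi S (ψ θ S Q) W) = f S (ψ θ S Q) (csi S (ψ θ S Q) W') → W θ = W' θ) :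
    IsAchievable f ((L : ℝ≥0∞) / n) := by
  classical
  have hne : ∀ θ S Lam, (Finset.univ.filter fun Q => ψ θ S Q = Lam).Nonempty := by
    intro θ S Lam
    rw [← Finset.card_pos]
    refine Nat.pos_of_mul_pos_left (a := Fintype.card (Coeffs F M)) ?_
    rw [card_coeffs_mul_card_fiber (hψ θ S)]
    exact Fintype.card_pos
  let σ : Scheme K M L F :=
    { Query := G
      query := fun θ S Lam => PMF.uniformOfFinset _ (hne θ S Lam)
      answer := ans
      prefix_free := fun Q W W' h => h.eq_of_length (by rw [hlen, hlen]) }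
  have hq : ∀ θ S Lam Q, σ.query θ S Lam Q ≠ 0 → ψ θ S Q = Lam := by
    intro θ S Lam Q h
    have := (PMF.mem_support_uniformOfFinset_iff (hne θ S Lam) Q).mp
      ((PMF.mem_support_iff _ _).mpr h)
    simpa using this
  refine ⟨σ, ?_, ?_, ?_⟩
  · refine σ.isPrivate_of_sum_query_eq hK hMK
      (fun _ => ((Fintype.card G / Fintype.card (Coeffs F M) : ℕ) : ℝ≥0∞)⁻¹) fun θ S Q => ?_
    -- Only Λ = ψ(Q) contributes, with the inverse of the common fibre size.
    rw [Finset.sum_eq_single (ψ θ S Q) (fun Lam _ h => by_contra fun h' => h (hq θ S Lam Q h').symm)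
      (fun h => absurd (Finset.mem_univ _) h)]
    simp only [σ]
    rw [PMF.uniformOfFinset_apply_of_mem _ (by simp),
      ← card_coeffs_mul_card_fiber (hψ θ S) (ψ θ S Q), Nat.mul_div_cancel_left _ Fintype.card_pos]
  · let P : List F → G → A → Support K M → Coeffs F M → Messages F K L → Prop :=
      fun l Q a S Lam W => ans Q W = l ∧ f S Lam (csi S Lam W) = a
    -- Decode from any messages consistent with the observations; the default 0 is never met with
    -- positive probability.
    refine ⟨fun l Q a S Lam => if h : ∃ W, P l Q a S Lam W then h.choose else 0, ?_⟩
    intro θ S Lam Q W hprob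
    obtain rfl := hq θ S Lam Q ((σ.prob_ne_zero_iff ..).mp hprob)
    have h : ∃ W', P (σ.answer Q W) Q (f S (ψ θ S Q) (csi S (ψ θ S Q) W)) S (ψ θ S Q) W' :=
      ⟨W, rfl, rfl⟩
    refine (congrFun (dif_pos h) θ).trans ?_
    exact hdec θ S Q _ _ h.choose_spec.1 h.choose_spec.2
  · rw [σ.avgDownload_of_length_eq hK hMK n hlen]

end Fibers

/-! ### Schemes from evaluation codes -/

variable {K M : ℕ} {F : Type} [Field F]

theorem csi_comp_orderEmbOfFin {L : ℕ} (S : Support K M) (l : Fin K → Fˣ) (W : Messages F K L) :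
    csi S (fun m => l (S.1.orderEmbOfFin S.2 m)) W = ∑ i ∈ S.1, (l i : F) • W i := by
  unfold csi
  conv_rhs => rw [← Finset.map_orderEmbOfFin_univ S.1 S.2, Finset.sum_map]
  rfl

/-- Downloading n power sums thus reveals every combination whose coefficients are multiplied by
values of a polynomial of degree below n. -/
theorem sum_mul_eval_eq_zero {c x : Fin K → F} {n : ℕ} (h : ∀ t < n, ∑ i, c i * x i ^ t = 0)
    {p : Polynomial F} (hp : p.natDegree < n) : ∑ i, c i * p.eval (x i) = 0 := by
  simp only [Polynomial.eval_eq_sum_range' hp, Finset.mul_sum]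
  rw [Finset.sum_comm]
  refine Finset.sum_eq_zero fun t ht => ?_
  rw [← mul_zero (p.coeff t), ← h t (Finset.mem_range.mp ht), Finset.mul_sum]
  exact Finset.sum_congr rfl fun i _ => by ring

/-- The monic polynomial whose roots are the points with index outside `T`. -/
noncomputable def locator (x : Fin K → F) (T : Finset (Fin K)) : Polynomial F :=
  ∏ j ∈ Tᶜ, (Polynomial.X - Polynomial.C (x j))

theorem natDegree_locator (x : Fin K → F) (T : Finset (Fin K)) :
    (locator x T).natDegree = K - T.card := by
  unfold locator
  rw [Polynomial.natDegree_prod_of_monic _ _ fun j _ => Polynomial.monic_X_sub_C _]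
  simp [Finset.card_compl]

theorem eval_locator_eq_zero (x : Fin K → F) {T : Finset (Fin K)} {i : Fin K} (hi : i ∉ T) :
    (locator x T).eval (x i) = 0 := by
  unfold locator
  rw [Polynomial.eval_prod]
  exact Finset.prod_eq_zero (Finset.mem_compl.mpr hi) (by simp)

theorem eval_locator_ne_zero {x : Fin K → F} (hx : Function.Injective x) {T : Finset (Fin K)}
    {i : Fin K} (hi : i ∈ T) : (locator x T).eval (x i) ≠ 0 := by
  unfold locator
  rw [Polynomial.eval_prod, Finset.prod_ne_zero_iff]
  intro j hj
  simp only [Polynomial.eval_sub, Polynomial.eval_X, Polynomial.eval_C, sub_ne_zero]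
  exact fun h => Finset.mem_compl.mp hj (hx h ▸ hi)

/-- A field element as a unit, with value `1` at zero. -/
noncomputable def toUnit (a : F) : Fˣ := by
  classical
  exact if h : a = 0 then 1 else Units.mk0 a h

theorem coe_toUnit {a : F} (h : a ≠ 0) : (toUnit a : F) = a := by
  simp [toUnit, h]

theorem sum_mul_sub_eq_zero {x c : Fin K → F} {n : ℕ} {w w' : Fin K → F}
    (h : List.ofFn (fun t : Fin n => ∑ i, c i * x i ^ (t : ℕ) * w i) =
      List.ofFn (fun t : Fin n => ∑ i, c i * x i ^ (t : ℕ) * w' i))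
    {p : Polynomial F} (hp : p.natDegree < n) :
    ∑ i, c i * (w i - w' i) * p.eval (x i) = 0 := by
  refine sum_mul_eval_eq_zero (fun t ht => ?_) hp
  have := congrFun (List.ofFn_injective h) ⟨t, ht⟩
  simp only at this
  rw [← sub_eq_zero, ← Finset.sum_sub_distrib] at this
  rw [← this]
  exact Finset.sum_congr rfl fun i _ => by ring

/-- The locator of S ∪ {θ} extracts from the answer a combination of exactly these messages, all
coefficients nonzero. The CSI is matched to it on S, except for a factor ζ at θ when θ ∈ S.
Subtraction leaves a nonzero multiple of W_θ: its own term if θ ∉ S, and ζ - 1 times it if θ ∈ S. -/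
theorem isAchievable_fullCSI [Fintype F] [DecidableEq F] (hM : 1 ≤ M) (hMK : M ≤ K)
    {x : Fin K → F} (hx : Function.Injective x) {ζ : Fˣ} (hζ : ζ ≠ 1) :
    IsAchievable (fullCSI K M 1 F) (1 / ((K - M + 1 : ℕ) : ℝ≥0∞)) := by
  let p : Fin K → Support K M → Polynomial F := fun θ S => locator x (insert θ S.1)
  let z : Fin K → Fin K → Fˣ := fun θ i => if i = θ then ζ else 1
  let u : Fin K → Support K M → (Fin K → Fˣ) → Fin K → Fˣ := fun θ S Q i =>
    Q i * (toUnit ((p θ S).eval (x i)) * z θ i)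
  have h := isAchievable_of_fibers (G := Fin K → Fˣ) (hM.trans hMK) hMK (fullCSI K M 1 F)
    (fun θ S Q m => u θ S Q (S.1.orderEmbOfFin S.2 m)) ?_
    (fun Q W => List.ofFn fun t : Fin (K - M + 1) => ∑ i, (Q i : F) * x i ^ (t : ℕ) * W i 0)
    (K - M + 1) (fun Q W => List.length_ofFn) ?_
  · simpa using h
  · intro θ S g
    -- Transport g to the indices in S and extend it by 1.
    refine ⟨fun i => if h : ∃ m, S.1.orderEmbOfFin S.2 m = i then g h.choose else 1,
      fun Q => funext fun m => ?_⟩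
    have hm : ∃ m', S.1.orderEmbOfFin S.2 m' = S.1.orderEmbOfFin S.2 m := ⟨m, rfl⟩
    have hc : hm.choose = m := (S.1.orderEmbOfFin S.2).injective hm.choose_spec
    simp only [u, Pi.mul_apply, dif_pos hm, hc, mul_assoc]
  · intro θ S Q W W' hans hY
    have hdeg : (p θ S).natDegree < K - M + 1 := by
      have h1 := natDegree_locator x (insert θ S.1)
      have h2 := Finset.card_le_card (Finset.subset_insert θ S.1)
      have h3 := S.2
      simp only [p]
      omega
    have h1 := sum_mul_sub_eq_zero hans hdeg
    simp only [fullCSI, csi_comp_orderEmbOfFin] at hY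
    have h2 := congrFun hY 0
    simp only [Finset.sum_apply, Pi.smul_apply, smul_eq_mul] at h2
    rw [← sub_eq_zero, ← Finset.sum_sub_distrib] at h2
    have hp : ∀ i ∈ insert θ S.1, (p θ S).eval (x i) ≠ 0 := fun i hi => eval_locator_ne_zero hx hi
    have h3 : ∑ i ∈ insert θ S.1, (Q i : F) * (W i 0 - W' i 0) * (p θ S).eval (x i) = 0 := by
      rw [← h1]
      refine Finset.sum_subset (Finset.subset_univ _) fun i _ hi => ?_
      rw [eval_locator_eq_zero x hi, mul_zero]
    have h4 : ∑ i ∈ S.1, (Q i : F) * (W i 0 - W' i 0) * (p θ S).eval (x i) * z θ i = 0 := by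
      rw [← h2]
      refine Finset.sum_congr rfl fun i hi => ?_
      simp only [u, Units.val_mul, coe_toUnit (hp i (Finset.mem_insert_of_mem hi))]
      ring
    have h5 : (W θ 0 - W' θ 0) = 0 := by
      have hpθ := hp θ (Finset.mem_insert_self _ _)
      by_cases hθ : θ ∈ S.1
      · rw [Finset.insert_eq_of_mem hθ, ← Finset.add_sum_erase _ _ hθ] at h3
        rw [← Finset.add_sum_erase _ _ hθ, Finset.sum_congr rfl (s₁ := S.1.erase θ)
          (g := fun i => (Q i : F) * (W i 0 - W' i 0) * (p θ S).eval (x i))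
          fun i hi => by simp [z, (Finset.mem_erase.mp hi).1]] at h4
        have hζ' : (ζ : F) - 1 ≠ 0 := sub_ne_zero.mpr fun h => hζ (Units.ext h)
        have h6 : (Q θ : F) * (p θ S).eval (x θ) * ((ζ : F) - 1) * (W θ 0 - W' θ 0) = 0 := by
          simp only [z, if_true] at h4
          linear_combination h4 - h3
        exact (mul_eq_zero.mp h6).resolve_left
          (mul_ne_zero (mul_ne_zero (Q θ).ne_zero hpθ) hζ')
      · rw [Finset.sum_insert hθ] at h3
        have : ∑ i ∈ S.1, (Q i : F) * (W i 0 - W' i 0) * (p θ S).eval (x i) = 0 := by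
          rw [← h4]
          refine Finset.sum_congr rfl fun i hi => ?_
          have : i ≠ θ := fun h => hθ (h ▸ hi)
          simp [z, this]
        rw [this, add_zero] at h3
        simpa [hpθ] using h3
    funext l
    rw [Subsingleton.elim l 0]
    exact sub_eq_zero.mp h5

end PIRPCSI

/-! ### Special schemes for M = 1 and M = 2 -/

namespace PIRPCSI

variable {K M : ℕ} {F : Type} [Field F] [Fintype F] [DecidableEq F]

/-- The differences from the last message make all messages known once one is, and the CSI reveals
one. The answer needs no query, so Λ itself serves as the query. -/
theorem isAchievable_fullCSI_one {k : ℕ} :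
    IsAchievable (fullCSI (k + 1) 1 1 F) (1 / (k : ℝ≥0∞)) := by
  have h := isAchievable_of_fibers (G := Coeffs F 1) (L := 1) (Nat.succ_pos k) (Nat.succ_pos k)
    (fullCSI (k + 1) 1 1 F) (fun _ _ Q => Q) (fun _ _ g => ⟨g, fun _ => rfl⟩)
    (fun _ W => List.ofFn fun i : Fin k => W i.castSucc 0 - W (Fin.last k) 0) k
    (fun _ _ => List.length_ofFn) ?_
  · simpa using h
  intro θ S Q W W' hans hY
  have h1 : ∀ i, W i 0 - W (Fin.last k) 0 = W' i 0 - W' (Fin.last k) 0 := by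
    intro i
    induction i using Fin.lastCases with
    | last => simp
    | cast i => exact congrFun (List.ofFn_injective hans) i
  obtain ⟨s, hs⟩ := Finset.card_eq_one.mp S.2
  have hs' : s ∈ S.1 := by simp [hs]
  have h2 : W s = W' s := eq_of_csi_eq hs' hY fun i hi his => by
    rw [hs, Finset.mem_singleton] at hi
    exact absurd hi his
  funext l
  rw [Subsingleton.elim l 0]
  linear_combination h1 θ - h1 s + congrFun h2 0

/-- Keeping one of the two symbols of the side information, in coordinates that depend on `Λ`. -/
def halfCSI (K : ℕ) (F : Type) [Field F] : Processing K 2 2 F F :=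
  fun _ Lam Y => Y 0 + Lam 0 * Y 1

omit [DecidableEq F] in
theorem usesAtMost_halfCSI : UsesAtMost (halfCSI K F) (1 / 2) := fun S Lam => by
  have hlog : 0 < Real.log (Fintype.card F) :=
    Real.log_pos (by exact_mod_cast Fintype.one_lt_card)
  refine (entropy_le_log_card _ Fintype.one_lt_card _).trans_eq ?_
  rw [div_self hlog.ne']
  norm_num

omit [Fintype F] [DecidableEq F] in
theorem support_two_eq (S : Support K 2) :
    S.1 = {S.1.orderEmbOfFin S.2 0, S.1.orderEmbOfFin S.2 1} := by
  ext i
  rw [← Finset.mem_coe, ← Finset.range_orderEmbOfFin S.1 S.2, Set.mem_range, Fin.exists_fin_two,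
    Finset.mem_insert, Finset.mem_singleton, eq_comm, @eq_comm _ _ i]

/-- Write c = `Q.1`. The first K symbols express each W_i(0) through W_i(1), so the processed CSI
becomes a combination of W_a(1), W_b(1) with coefficients λ₀(λ₀ - c y_a) and λ₁(λ₀ - c y_b). If θ ∈
S, take λ₀ to cancel the other message. If θ ∉ S, take λ₀ = c y_θ and λ₁ so that the combination is
proportional to the one extracted by the locator of {a, b, θ}, of degree K - 3, from the K - 2 power
sums. -/
theorem isAchievable_halfCSI (hK : 2 ≤ K) {x : Fin K → Fˣ} (hx : Function.Injective x) :
    IsAchievable (halfCSI K F) (2 / ((K + (K - 2) : ℕ) : ℝ≥0∞)) := by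
  let a : Support K 2 → Fin K := fun S => S.1.orderEmbOfFin S.2 0
  let b : Support K 2 → Fin K := fun S => S.1.orderEmbOfFin S.2 1
  let y : Fin K → F := fun i => x i
  have hy : Function.Injective y := fun i j h => hx (Units.ext h)
  let p : Fin K → Support K 2 → Polynomial F := fun θ S => locator y (insert θ S.1)
  -- The part of λ₁ fixed by (θ, S), from equating the ratio of the two coefficients with that of
  -- the locator combination.
  let κ : Fin K → Support K 2 → F := fun θ S =>
    ((p θ S).eval (y (b S)) * (y θ - y (a S))) / ((p θ S).eval (y (a S)) * (y θ - y (b S)))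
  let ψ : Fin K → Support K 2 → Fˣ × (Fin K → Fˣ) → Coeffs F 2 := fun θ S Q =>
    if θ ∈ S.1 then ![Q.1 * (if θ = a S then x (b S) else x (a S)), Q.2 (b S)]
    else ![Q.1 * x θ, Q.1 * Q.2 (b S) * (Q.2 (a S))⁻¹ * (x θ * toUnit (κ θ S))]
  have hab : ∀ S, a S ≠ b S := fun S h => by
    have := (S.1.orderEmbOfFin S.2).injective h
    simp at this
  have h := isAchievable_of_fibers (G := Fˣ × (Fin K → Fˣ)) (by omega) hK (halfCSI K F) ψ ?_
    (fun Q W => (List.ofFn fun i => W i 0 + Q.1 * y i * W i 1) ++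
      List.ofFn fun t : Fin (K - 2) => ∑ i, (Q.2 i : F) * y i ^ (t : ℕ) * W i 1)
    (K + (K - 2)) (fun Q W => by simp) ?_
  · simpa using h
  · intro θ S g
    by_cases hθ : θ ∈ S.1
    · refine ⟨(g 0, Pi.mulSingle (b S) (g 1)), fun Q => ?_⟩
      funext m
      fin_cases m <;> simp [ψ, hθ, mul_assoc]
    -- Here `Q.1` also enters λ₁, so the factor g 0 has to be undone at b.
    · refine ⟨(g 0, Pi.mulSingle (b S) (g 1 * (g 0)⁻¹)), fun Q => ?_⟩
      funext m
      fin_cases m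
      · simp [ψ, hθ, mul_assoc]
      · simp only [ψ, hθ, if_false, Fin.mk_one, Matrix.cons_val_one,
          Prod.fst_mul, Prod.snd_mul, Pi.mul_apply, Pi.mulSingle_eq_same,
          Pi.mulSingle_eq_of_ne (hab S), one_mul, Matrix.cons_val_fin_one]
        rw [show g 0 * Q.1 * (g 1 * (g 0)⁻¹ * Q.2 (b S)) = g 1 * (Q.1 * Q.2 (b S)) by
          rw [show g 0 * Q.1 * (g 1 * (g 0)⁻¹ * Q.2 (b S)) =
            g 0 * (g 0)⁻¹ * (g 1 * (Q.1 * Q.2 (b S))) by ac_rfl, mul_inv_cancel, one_mul]]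
        simp only [mul_assoc]
  · intro θ S Q W W' hans hY
    obtain ⟨hans₁, hans₂⟩ := List.append_inj hans (by simp)
    have hA : ∀ i, (W i 0 - W' i 0) + Q.1 * y i * (W i 1 - W' i 1) = 0 := fun i => by
      linear_combination congrFun (List.ofFn_injective hans₁) i
    suffices hθ : W θ 1 - W' θ 1 = 0 by
      have h0 := hA θ
      rw [hθ, mul_zero, add_zero] at h0
      funext l
      fin_cases l
      · exact sub_eq_zero.mp h0
      · exact sub_eq_zero.mp hθ
    have hY' : ((ψ θ S Q 0 : F) * (ψ θ S Q 0 - Q.1 * y (a S))) * (W (a S) 1 - W' (a S) 1) +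
        ((ψ θ S Q 1 : F) * (ψ θ S Q 0 - Q.1 * y (b S))) * (W (b S) 1 - W' (b S) 1) = 0 := by
      simp only [halfCSI, csi, Fin.sum_univ_two, Pi.add_apply, Pi.smul_apply, smul_eq_mul] at hY
      linear_combination hY - (ψ θ S Q 0 : F) * hA (a S) - (ψ θ S Q 1 : F) * hA (b S)
    by_cases hθ : θ ∈ S.1
    · have hne : y (b S) - y (a S) ≠ 0 := sub_ne_zero.mpr fun h => hab S (hy h).symm
      rw [support_two_eq S, Finset.mem_insert, Finset.mem_singleton] at hθ
      rcases hθ with hθ | hθ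
      · have h0 : ψ θ S Q 0 = Q.1 * x (b S) := by
          simp [ψ, show θ = a S from hθ, show a S ∈ S.1 from Finset.orderEmbOfFin_mem _ _ _]
        rw [h0] at hY'
        change θ = a S at hθ
        rw [← hθ] at hY' hne
        have : ((Q.1 * x (b S) : Fˣ) : F) * Q.1 * (y (b S) - y θ) * (W θ 1 - W' θ 1) = 0 := by
          simp only [y, Units.val_mul] at hY' ⊢
          linear_combination hY'
        exact (mul_eq_zero.mp this).resolve_left
          (mul_ne_zero (mul_ne_zero (Units.ne_zero _) (Units.ne_zero _)) hne)
      · have h0 : ψ θ S Q 0 = Q.1 * x (a S) := by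
          simp [ψ, show θ = b S from hθ, (hab S).symm,
            show b S ∈ S.1 from Finset.orderEmbOfFin_mem _ _ _]
        rw [h0] at hY'
        change θ = b S at hθ
        rw [← hθ] at hY' hne
        have : (ψ θ S Q 1 : F) * Q.1 * (y θ - y (a S)) * (W θ 1 - W' θ 1) = 0 := by
          simp only [y, Units.val_mul] at hY' ⊢
          linear_combination -hY'
        exact (mul_eq_zero.mp this).resolve_left
          (mul_ne_zero (mul_ne_zero (Units.ne_zero _) (Units.ne_zero _)) hne)
    · have ha : a S ∈ S.1 := Finset.orderEmbOfFin_mem _ _ _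
      have hb : b S ∈ S.1 := Finset.orderEmbOfFin_mem _ _ _
      have hcard : (insert θ S.1).card = 3 := by rw [Finset.card_insert_of_notMem hθ, S.2]
      have hK3 : 3 ≤ K := by
        rw [← hcard]
        exact (Finset.card_le_univ _).trans_eq (Fintype.card_fin K)
      have h1 := sum_mul_sub_eq_zero (c := fun i => (Q.2 i : F)) hans₂ (p := p θ S) (by
        simp only [p]
        rw [natDegree_locator, hcard]
        omega)
      have hp : ∀ i ∈ insert θ S.1, (p θ S).eval (y i) ≠ 0 :=
        fun i hi => eval_locator_ne_zero hy hi
      have hpa := hp _ (Finset.mem_insert_of_mem ha)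
      have hpb := hp _ (Finset.mem_insert_of_mem hb)
      have hpθ := hp _ (Finset.mem_insert_self θ _)
      have h3 : ∑ i ∈ insert θ S.1, (Q.2 i : F) * (W i 1 - W' i 1) * (p θ S).eval (y i) = 0 := by
        rw [← h1]
        refine Finset.sum_subset (Finset.subset_univ _) fun i _ hi => ?_
        rw [eval_locator_eq_zero y hi, mul_zero]
      rw [Finset.sum_insert hθ, support_two_eq S, Finset.sum_pair (hab S)] at h3
      change _ + ((Q.2 (a S) : F) * (W (a S) 1 - W' (a S) 1) * (p θ S).eval (y (a S)) +
        (Q.2 (b S) : F) * (W (b S) 1 - W' (b S) 1) * (p θ S).eval (y (b S))) = 0 at h3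
      have hya : y θ - y (a S) ≠ 0 := sub_ne_zero.mpr fun h => hθ (hy h ▸ ha)
      have hyb : y θ - y (b S) ≠ 0 := sub_ne_zero.mpr fun h => hθ (hy h ▸ hb)
      have hκ : κ θ S ≠ 0 := div_ne_zero (mul_ne_zero hpb hya) (mul_ne_zero hpa hyb)
      have h4 : (Q.2 (a S) : F) * (W (a S) 1 - W' (a S) 1) * (p θ S).eval (y (a S)) +
          (Q.2 (b S) : F) * (W (b S) 1 - W' (b S) 1) * (p θ S).eval (y (b S)) = 0 := by
        have h0 : (ψ θ S Q 0 : F) = Q.1 * y θ := by simp [ψ, hθ, y]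
        have h1 : (ψ θ S Q 1 : F) = Q.1 * Q.2 (b S) * (Q.2 (a S) : F)⁻¹ * (y θ * κ θ S) := by
          simp [ψ, hθ, y, coe_toUnit hκ]
        have hQa : (Q.2 (a S) : F) ≠ 0 := Units.ne_zero _
        have hyθ : y θ ≠ 0 := Units.ne_zero _
        have hκ' : κ θ S * (y θ - y (b S)) * (p θ S).eval (y (a S)) =
            (p θ S).eval (y (b S)) * (y θ - y (a S)) := by
          simp only [κ]
          field_simp
        rw [h0, h1] at hY'
        have hinv : (Q.2 (a S) : F) * (Q.2 (a S) : F)⁻¹ = 1 := mul_inv_cancel₀ hQa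
        have : ((Q.1 : F) * Q.1 * y θ * (y θ - y (a S))) *
            ((Q.2 (a S) : F) * (W (a S) 1 - W' (a S) 1) * (p θ S).eval (y (a S)) +
              (Q.2 (b S) : F) * (W (b S) 1 - W' (b S) 1) * (p θ S).eval (y (b S))) = 0 := by
          linear_combination (Q.2 (a S) : F) * (p θ S).eval (y (a S)) * hY' -
            (Q.1 : F) * Q.1 * y θ * Q.2 (b S) * (W (b S) 1 - W' (b S) 1) * hκ' -
            (Q.1 : F) * Q.1 * y θ * Q.2 (b S) * (W (b S) 1 - W' (b S) 1) * κ θ S *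
              (y θ - y (b S)) * (p θ S).eval (y (a S)) * hinv
        exact (mul_eq_zero.mp this).resolve_left (mul_ne_zero (mul_ne_zero
          (mul_ne_zero (Units.ne_zero _) (Units.ne_zero _)) hyθ) hya)
      rw [h4, add_zero] at h3
      refine (mul_eq_zero.mp ((mul_eq_zero.mp h3).resolve_right hpθ)).resolve_left
        (Units.ne_zero _)

end PIRPCSI

/-! ### Capacities and the least sufficient α -/

namespace PIRPCSI

section Constrained

variable {K M L : ℕ} {F A : Type} [Field F] [Fintype F] [DecidableEq F]

theorem IsAchievable.fullCSI {f : Processing K M L F A} {R : ℝ≥0∞} (h : IsAchievable f R) :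
    IsAchievable (fullCSI K M L F) R := by
  obtain ⟨σ, hp, ⟨dec, hdec⟩, hR⟩ := h
  exact ⟨σ, hp, ⟨fun l Q Y S Lam θ => dec l Q (f S Lam Y) S Lam θ, hdec⟩, hR⟩

theorem constrainedCapacity_le_capacity (α : ℝ) :
    constrainedCapacity K M F α ≤ capacity K M F := by
  refine sSup_le ?_
  rintro R ⟨L, hL, A, f, -, hR⟩
  exact le_sSup ⟨L, hL, hR.fullCSI⟩

theorem capacity_le_constrainedCapacity_one :
    capacity K M F ≤ constrainedCapacity K M F 1 := by
  refine sSup_le ?_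
  rintro R ⟨L, hL, hR⟩
  exact le_sSup ⟨L, hL, _, PIRPCSI.fullCSI K M L F, usesAtMost_fullCSI, hR⟩

theorem constrainedCapacity_le (hM : 1 ≤ M) (hMK : M ≤ K) (α : ℝ) :
    constrainedCapacity K M F α ≤ (ENNReal.ofReal (K - M * α))⁻¹ := by
  refine sSup_le ?_
  rintro R ⟨L, hL, A, f, hα, hR⟩
  exact rate_le_of_usesAtMost hα hM hMK hL hR

theorem constrainedCapacity_le_of_two_le (hM : 2 ≤ M) (hMK : M ≤ K) (α : ℝ) :
    constrainedCapacity K M F α ≤ (ENNReal.ofReal (K - (1 + (M - 2) * α)))⁻¹ := by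
  refine sSup_le ?_
  rintro R ⟨L, hL, A, f, hα, hR⟩
  exact rate_le_of_usesAtMost_of_two_le hα hM hMK hL hR

end Constrained

variable {K M : ℕ}

theorem constrainedCapacity_le_iSup (F : Type) [hF : Field F] [hF' : Fintype F]
    [hF'' : DecidableEq F] (α : ℝ) : constrainedCapacity K M F α ≤
      ⨆ (F : Type) (_ : Field F) (_ : Fintype F) (_ : DecidableEq F),
        constrainedCapacity K M F α :=
  le_iSup_of_le F <| le_iSup_of_le hF <| le_iSup_of_le hF' <| le_iSup_of_le hF'' le_rfl

theorem capacity_le_supCapacity (F : Type) [hF : Field F] [hF' : Fintype F]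
    [hF'' : DecidableEq F] : capacity K M F ≤ supCapacity K M :=
  le_iSup_of_le F <| le_iSup_of_le hF <| le_iSup_of_le hF' <| le_iSup_of_le hF'' le_rfl

theorem iSup_constrainedCapacity_le_supCapacity (α : ℝ) :
    ⨆ (F : Type) (_ : Field F) (_ : Fintype F) (_ : DecidableEq F),
      constrainedCapacity K M F α ≤ supCapacity K M :=
  iSup_mono fun _ => iSup_mono fun _ => iSup_mono fun _ => iSup_mono fun _ =>
    constrainedCapacity_le_capacity α

theorem csiSufficient_one (K M : ℕ) : CSISufficient K M 1 :=
  le_antisymm (iSup_constrainedCapacity_le_supCapacity 1)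
    (iSup_mono fun _ => iSup_mono fun _ => iSup_mono fun _ => iSup_mono fun _ =>
      capacity_le_constrainedCapacity_one)

theorem supCapacity_le {c : ℝ≥0∞}
    (h : ∀ (F : Type) [Field F] [Fintype F] [DecidableEq F], constrainedCapacity K M F 1 ≤ c) :
    supCapacity K M ≤ c :=
  iSup_le fun F => iSup_le fun _ => iSup_le fun _ => iSup_le fun _ =>
    capacity_le_constrainedCapacity_one.trans (h F)

/-- Processed side information is insufficient if some converse bound beats the supremum
capacity. -/
theorem not_csiSufficient {α d d' : ℝ} (hd : 0 ≤ d) (hdd' : d < d')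
    (hle : (ENNReal.ofReal d)⁻¹ ≤ supCapacity K M)
    (h : ∀ (F : Type) [Field F] [Fintype F] [DecidableEq F],
      constrainedCapacity K M F α ≤ (ENNReal.ofReal d')⁻¹) : ¬ CSISufficient K M α := by
  intro hs
  have h1 : supCapacity K M ≤ (ENNReal.ofReal d')⁻¹ := by
    rw [← hs]
    exact iSup_le fun F => iSup_le fun _ => iSup_le fun _ => iSup_le fun _ => h F
  have h2 : (ENNReal.ofReal d')⁻¹ < (ENNReal.ofReal d)⁻¹ :=
    ENNReal.inv_lt_inv.mpr ((ENNReal.ofReal_lt_ofReal_iff (hd.trans_lt hdd')).mpr hdd')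
  exact absurd (hle.trans h1) (not_le.mpr h2)

/-- A prime p ≥ K + 3 leaves at least K + 2 units. The points are taken nonzero because
`isAchievable_halfCSI` uses them as factors of λ₀. -/
theorem exists_large_field (K : ℕ) : ∃ (F : Type) (_ : Field F) (_ : Fintype F)
    (_ : DecidableEq F), (∃ x : Fin K → Fˣ, Function.Injective x) ∧ ∃ ζ : Fˣ, ζ ≠ 1 := by
  obtain ⟨p, hp, hprime⟩ := Nat.exists_infinite_primes (K + 3)
  have : Fact p.Prime := ⟨hprime⟩
  have hcard : Fintype.card (ZMod p)ˣ = p - 1 := by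
    rw [ZMod.card_units_eq_totient, Nat.totient_prime hprime]
  refine ⟨ZMod p, inferInstance, inferInstance, inferInstance, ?_, ?_⟩
  · obtain ⟨e⟩ := Function.Embedding.nonempty_of_card_le
      (show Fintype.card (Fin K) ≤ Fintype.card (ZMod p)ˣ by rw [hcard, Fintype.card_fin]; omega)
    exact ⟨e, e.injective⟩
  · have : Nontrivial (ZMod p)ˣ := Fintype.one_lt_card_iff_nontrivial.mp (by omega)
    exact exists_ne 1

theorem inv_le_supCapacity (hM : 1 ≤ M) (hMK : M ≤ K) :
    (ENNReal.ofReal (K - (M - 1)))⁻¹ ≤ supCapacity K M := by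
  obtain ⟨F, _, _, _, ⟨x, hx⟩, ζ, hζ⟩ := exists_large_field K
  refine le_trans ?_ (capacity_le_supCapacity F)
  refine le_sSup ⟨1, le_rfl, ?_⟩
  have h := isAchievable_fullCSI hM hMK (x := fun i => (x i : F))
    (fun i j h => hx (Units.ext h)) hζ
  convert h using 1
  rw [one_div, ← ENNReal.ofReal_natCast]
  push_cast [hMK]
  congr 2
  ring

/-- For K = 1 nothing is downloaded and both sides are ∞. -/
theorem inv_le_supCapacity_one (hK : 1 ≤ K) :
    (ENNReal.ofReal (K - 1))⁻¹ ≤ supCapacity K 1 := by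
  obtain ⟨k, rfl⟩ := Nat.exists_eq_add_of_le' hK
  obtain ⟨F, _, _, _, -, -⟩ := exists_large_field k
  have h : (k : ℝ≥0∞)⁻¹ ≤ capacity (k + 1) 1 F := by
    refine le_sSup ⟨1, le_rfl, ?_⟩
    rw [← one_div]
    exact isAchievable_fullCSI_one
  refine le_trans (le_of_eq ?_) (h.trans (capacity_le_supCapacity F))
  rw [Nat.cast_add_one, add_sub_cancel_right, ENNReal.ofReal_natCast]

/-- For M = 2 the second converse bound is 1/(K - 1) whatever α is, and 2/(2K - 2) meets it. -/
theorem csiSufficient_half (hK : 2 ≤ K) : CSISufficient K 2 (1 / 2) := by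
  refine le_antisymm (iSup_constrainedCapacity_le_supCapacity _) ?_
  have h1 : supCapacity K 2 ≤ (ENNReal.ofReal (K - 1))⁻¹ := supCapacity_le fun F _ _ _ =>
    (constrainedCapacity_le_of_two_le le_rfl hK 1).trans_eq (by norm_num)
  refine h1.trans ?_
  obtain ⟨F, _, _, _, ⟨x, hx⟩, -⟩ := exists_large_field K
  refine le_trans ?_ (constrainedCapacity_le_iSup F (1 / 2))
  refine le_sSup ⟨2, one_le_two, F, halfCSI K F, usesAtMost_halfCSI, ?_⟩
  convert isAchievable_halfCSI hK hx using 1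
  obtain ⟨k, rfl⟩ := Nat.exists_eq_add_of_le' hK
  have h2 : ENNReal.ofReal (((k + 2 : ℕ) : ℝ) - 1) = ((k + 1 : ℕ) : ℝ≥0∞) := by
    rw [← ENNReal.ofReal_natCast]
    push_cast
    congr 1
    ring
  rw [h2, show k + 2 + (k + 2 - 2) = 2 * (k + 1) by omega, Nat.cast_mul 2, Nat.cast_two,
    div_eq_mul_inv, ENNReal.mul_inv (by simp) (by simp), ← mul_assoc,
    ENNReal.mul_inv_cancel two_ne_zero ENNReal.ofNat_ne_top, one_mul]

theorem isLeast_csiSufficient_two (hK : 2 ≤ K) :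
    IsLeast {α : ℝ | CSISufficient K 2 α} (1 / 2) := by
  refine ⟨csiSufficient_half hK, fun α hα => le_of_not_gt fun hlt => ?_⟩
  have hK' : (2 : ℝ) ≤ K := by exact_mod_cast hK
  refine not_csiSufficient (d := K - ((2 : ℕ) - 1)) (d' := K - (2 : ℕ) * α) ?_ ?_
    (inv_le_supCapacity one_le_two hK)
    (fun F _ _ _ => constrainedCapacity_le one_le_two hK α) hα <;> push_cast <;> linarith

theorem isLeast_csiSufficient_one (hM : 1 ≤ M) (hMK : M ≤ K) (hM2 : M ≠ 2) :
    IsLeast {α : ℝ | CSISufficient K M α} 1 := by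
  refine ⟨csiSufficient_one K M, fun α hα => le_of_not_gt fun hlt => ?_⟩
  have hK' : (M : ℝ) ≤ K := by exact_mod_cast hMK
  rcases hM.eq_or_lt with rfl | hM1
  · refine not_csiSufficient (d := K - 1) (d' := K - (1 : ℕ) * α) ?_ ?_
      (inv_le_supCapacity_one hMK) (fun F _ _ _ => constrainedCapacity_le le_rfl hMK α) hα <;>
      push_cast at * <;> linarith
  · have hM3 : (3 : ℝ) ≤ M := by exact_mod_cast (by omega : 3 ≤ M)
    refine not_csiSufficient (d := K - (M - 1)) (d' := K - (1 + (M - 2) * α)) ?_ ?_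
      (inv_le_supCapacity hM hMK)
      (fun F _ _ _ => constrainedCapacity_le_of_two_le (by omega) hMK α) hα
    · linarith
    · nlinarith

end PIRPCSI

theorem theorem11 (K M : ℕ) (hM : 1 ≤ M) (hMK : M ≤ K) :
    (M = 2 →
      IsLeast {α : ℝ | PIRPCSI.CSISufficient K M α} (1 / 2) ∧
        PIRPCSI.redundancy K M = 1 / 2) ∧
    (3 ≤ M ∧ (M : ℝ) ≤ ((K : ℝ) + 2) / 2 →
      PIRPCSI.redundancy K M ≤ 1 / (M : ℝ)) ∧
    (¬ M = 2 ∧ ¬ (3 ≤ M ∧ (M : ℝ) ≤ ((K : ℝ) + 2) / 2) →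
      IsLeast {α : ℝ | PIRPCSI.CSISufficient K M α} 1 ∧
        PIRPCSI.redundancy K M = 0) := by
  refine ⟨?_, ?_, ?_⟩
  · rintro rfl
    have h := PIRPCSI.isLeast_csiSufficient_two hMK
    refine ⟨h, ?_⟩
    rw [PIRPCSI.redundancy, h.csInf_eq]
    norm_num
  -- The redundancy is in fact 0 in this range, which is stronger than 1/M.
  · rintro ⟨hM3, -⟩
    rw [PIRPCSI.redundancy,
      (PIRPCSI.isLeast_csiSufficient_one hM hMK (by omega)).csInf_eq, sub_self]
    positivity
  · rintro ⟨hM2, -⟩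
    have h := PIRPCSI.isLeast_csiSufficient_one hM hMK hM2
    refine ⟨h, ?_⟩
    rw [PIRPCSI.redundancy, h.csInf_eq, sub_self]
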